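/- Let $N\in\mathbb N$ and let $\ell_1\neq\ell_2$ be integers in $\{1,\dots,N-2\}$. Identify the complex signals $x=(x[n])_{n\in\mathbb Z}$ that vanish outside $\{0,\dots,N-1\}$ with the vectors $(x[0],\dots,x[N-1])\in\mathbb C^N\cong\mathbb R^{2N}$, and let "almost every" refer to Lebesgue measure (so almost every such signal has support exactly $\{0,\dots,N-1\}$). Write $\hat x(\omega)=\sum_{n\in\mathbb Z}x[n]\,e^{-i\omega n}$ for $\omega\in\mathbb R$. For a signal $x$, let $\mathcal S(x)$ be the set of all signals $y$ vanishing outside $\{0,\dots,N-1\}$ such that $|\hat y(\omega)|=|\hat x(\omega)|$ for all $\omega\in\mathbb R$ and, for $j=1,2$, $\arg y[N-1-\ell_j]=\arg x[N-1-\ell_j]$, where the phase of $0$ is regarded as undetermined, so that this condition also counts as satisfied when $y[N-1-\ell_j]=0$ or $x[N-1-\ell_j]=0$. (i) If $\ell_1+\ell_2\neq N-1$, then $\mathcal S(x)=\{x\}$ for almost every $x$; that is, almost every signal with support $\{0,\dots,N-1\}$ is uniquely determined by $|\hat x|$, $\arg x[N-1-\ell_1]$ and $\arg x[N-1-\ell_2]$.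 (ii) If $\ell_1+\ell_2=N-1$, then for almost every $x$ the set $\mathcal S(x)$ consists of exactly two different signals: $x$ itself and the rotated conjugate reflection $\tilde x$ given by $$\tilde x[n]=e^{i(\arg x[N-1-\ell_1]+\arg x[N-1-\ell_2])}\;\overline{x[N-1-n]}\qquad(n\in\mathbb Z);$$ that is, almost every signal is determined by these data only up to conjugate reflection. -/

import Mathlib

open MeasureTheory

noncomputable section

namespace PhaseRetrieval

/-- The discrete-time signal `(x[n])_{n ∈ ℤ}` supported in `{0, …, N - 1}` whose values there are
the coordinates of `v ∈ ℂ^N`. -/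
def toSignal {N : ℕ} (v : Fin N → ℂ) : ℤ → ℂ := fun n =>
  if h : 0 ≤ n ∧ n < (N : ℤ) then v ⟨n.toNat, by omega⟩ else 0

/-- The discrete-time Fourier transform `ω ↦ ∑_{n ∈ ℤ} x[n] e^{-iωn}` of a signal with finite
support (the sum is a finite sum over the support). -/
def fourierTransform (x : ℤ → ℂ) (ω : ℝ) : ℂ :=
  ∑ᶠ n : ℤ, x n * Complex.exp (-Complex.I * (ω : ℂ) * (n : ℂ))

/-- Two complex numbers have the same phase. The phase of `0` is not determined, so `0` is
compatible with every phase. -/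
def SamePhase (z w : ℂ) : Prop :=
  z = 0 ∨ w = 0 ∨ Complex.arg z = Complex.arg w

/-- `y` is a solution of the phase retrieval problem on `{0, …, N - 1}` for the data coming from
`x`: the Fourier intensity `|x̂|` and the phases of `x` at the two points `n₁` and `n₂`. -/
structure IsSolution (N : ℕ) (n₁ n₂ : ℤ) (x y : ℤ → ℂ) : Prop where
  support_subset : Function.support y ⊆ Set.Icc 0 ((N : ℤ) - 1)
  intensity : ∀ ω : ℝ, ‖fourierTransform y ω‖ = ‖fourierTransform x ω‖
  phase₁ : SamePhase (y n₁) (x n₁)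
  phase₂ : SamePhase (y n₂) (x n₂)

/-- The conjugate reflection of `x` within `{0, …, N - 1}`, rotated by the angle `α`:
`n ↦ e^{iα} · conj (x[N - 1 - n])`. -/
def conjReflection (N : ℕ) (α : ℝ) (x : ℤ → ℂ) : ℤ → ℂ := fun n =>
  Complex.exp (Complex.I * (α : ℂ)) * (starRingEnd ℂ) (x ((N : ℤ) - 1 - n))

end PhaseRetrieval

end

/-! Put M = N - 1, n_j = M - ℓ_j, let p be the polynomial with the values of the signal as
coefficients, and write p* for its conjugate reciprocal. The intensity is |p| on the unit circle, so
it determines p p*. Since ℂ[X] is factorial, any other q of degree at most M with q q* = p p* has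
the form q = c f g* with p = f g, g monic and |c| = 1, provided the end coefficients of p do not
vanish.

Agreement of the phases at n₁ and n₂ makes q_{n₁} conj(q_{n₂}) conj(p_{n₁}) p_{n₂} real, a condition
(`phaseForm` = 0) that no longer involves c. For fixed degrees a + b = M, the pairs (f, g) have a +
1 + b = N complex parameters, as many as the signal. If the form is not identically zero on these
pairs, its zero set is null, because the form is real-analytic; the image of that set under (f, g) ↦
f g is null as well (`ae_forall_phaseForm_ne_zero`). So almost every p has no factorization of this
type compatible with the phases.

It remains to find, for each b ≥ 1, one pair with nonzero form. For a ≥ 1, fix g; the four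
coefficients are then linear forms in f, and a perturbation argument on a kernel applies
(`exists_im_ne_zero`). For a = 0, an explicit g works exactly when n₁ + n₂ ≠ M; if n₁ + n₂ = M, the
form vanishes identically, and q is p* up to a unimodular constant: the conjugate reflection. The
constant left in each surviving case is fixed by one phase. -/

/-! ### Null zero sets of real-analytic functions -/

open scoped Pointwise in
/-- The zero set of a nonzero real-analytic function on a finite-dimensional real vector space is
a null set. -/
theorem AnalyticOnNhd.addHaar_zeros_eq_zero {E : Type*} [NormedAddCommGroup E] [NormedSpace ℝ E]
    [FiniteDimensional ℝ E] [MeasurableSpace E] [BorelSpace E] (μ : Measure E)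
    [μ.IsAddHaarMeasure] {f : E → ℝ} (hf : AnalyticOnNhd ℝ f Set.univ) {p : E} (hp : f p ≠ 0) :
    μ {x | f x = 0} = 0 := by
  have hcont : Continuous f := hf.continuous
  let S : Set (E × ℝ) := {z | f (p + z.2 • z.1) = 0}
  have hS : MeasurableSet S := by
    refine (isClosed_eq ?_ continuous_const).measurableSet
    fun_prop
  -- On each line through p, f is analytic in one variable and nonzero at t = 0, so its zeros are
  -- discrete.
  have hslice : ∀ x : E, volume {t : ℝ | f (p + t • x) = 0} = 0 := by
    intro x
    have han : AnalyticOnNhd ℝ (fun t : ℝ => f (p + t • x)) Set.univ := by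
      intro t _
      refine AnalyticAt.fun_comp (hf _ trivial) (by fun_prop)
    have h := han.preimage_zero_mem_codiscrete (x := (0 : ℝ)) (by simpa using hp)
    have h2 := ae_restrict_le_codiscreteWithin (α := ℝ) (μ := volume) MeasurableSet.univ h
    rw [Measure.restrict_univ] at h2
    have h3 := mem_ae_iff.1 h2
    convert h3 using 2
    ext t; simp
  have hprod : (μ.prod volume) S = 0 := by
    rw [Measure.prod_apply hS]
    simp only [lintegral_eq_zero_iff' (measurable_measure_prodMk_left hS).aemeasurable]
    exact Filter.Eventually.of_forall fun x => hslice x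
  have hae := Measure.ae_ae_of_ae_prod (μ := (volume : Measure ℝ)) (ν := μ)
    (p := fun z => f (p + z.1 • z.2) ≠ 0) (by
      rw [ae_iff]
      have := (Measure.prod_swap (μ := μ) (ν := (volume : Measure ℝ)))
      rw [← this, Measure.map_apply measurable_swap]
      · simpa [S, Set.preimage] using hprod
      · simp only [ne_eq, not_not]
        refine (isClosed_eq ?_ continuous_const).measurableSet
        fun_prop)
  -- By Fubini some scale t ≠ 0 has a null slice, and the zero set of f is an affine image of that
  -- slice.
  obtain ⟨t, ht, ht0⟩ := (hae.and (Measure.ae_ne volume (0 : ℝ))).exists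
  have hsub : {x | f x = 0} = (fun x => p + x) '' (t • {x | f (p + t • x) = 0}) := by
    ext x
    simp only [Set.mem_ofPred_eq, Set.mem_image, Set.mem_smul_set]
    constructor
    · intro hx
      refine ⟨x - p, ⟨t⁻¹ • (x - p), ?_, ?_⟩, by abel⟩ <;> simp [smul_smul, ht0, hx]
    · rintro ⟨_, ⟨y, hy, rfl⟩, rfl⟩
      exact hy
  rw [hsub, Set.image_add_left, measure_preimage_add, Measure.addHaar_smul]
  have : μ {x | f (p + t • x) = 0} = 0 := by simpa [ae_iff] using ht
  rw [this, mul_zero]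

/-! ### Conjugate reciprocal polynomials and equal autocorrelations -/

namespace PhaseRetrieval

open Polynomial ComplexConjugate

/-- The conjugate reciprocal `z ↦ z ^ n * conj (p (1 / conj z))` of a polynomial `p` of degree at
most `n`. -/
noncomputable def conjReflect (n : ℕ) (p : ℂ[X]) : ℂ[X] := (p.map (starRingEnd ℂ)).reflect n

theorem coeff_conjReflect {n k : ℕ} (p : ℂ[X]) (h : k ≤ n) :
    (conjReflect n p).coeff k = conj (p.coeff (n - k)) := by
  simp [conjReflect, revAt_le h]

theorem natDegree_conjReflect_le {n : ℕ} {p : ℂ[X]} (h : p.natDegree ≤ n) :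
    (conjReflect n p).natDegree ≤ n := by
  refine natDegree_reflect_le.trans ?_
  simp [h]

theorem conjReflect_mul {m n : ℕ} {p q : ℂ[X]} (hp : p.natDegree ≤ m) (hq : q.natDegree ≤ n) :
    conjReflect (m + n) (p * q) = conjReflect m p * conjReflect n q := by
  rw [conjReflect, Polynomial.map_mul, reflect_mul _ _ (by simpa) (by simpa)]; rfl

theorem conjReflect_C_mul (n : ℕ) (c : ℂ) (p : ℂ[X]) :
    conjReflect n (C c * p) = C (conj c) * conjReflect n p := by
  simp [conjReflect]

theorem conjReflect_conjReflect (n : ℕ) (p : ℂ[X]) : conjReflect n (conjReflect n p) = p := by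
  ext k
  simp [conjReflect]

theorem conjReflect_eq_zero_iff {n : ℕ} {p : ℂ[X]} : conjReflect n p = 0 ↔ p = 0 := by
  simp [conjReflect, Polynomial.map_eq_zero_iff (RingHom.injective (starRingEnd ℂ))]

theorem eval_conjReflect {n : ℕ} {p : ℂ[X]} (hp : p.natDegree ≤ n) {z : ℂ} (hz : ‖z‖ = 1) :
    (conjReflect n p).eval z = z ^ n * conj (p.eval z) := by
  have hz0 : z ≠ 0 := by rintro rfl; simp at hz
  have hc : conj z = z⁻¹ := (Complex.inv_eq_conj hz).symm
  have hc0 : conj z ≠ 0 := by rw [hc]; exact inv_ne_zero hz0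
  let _ : Invertible (conj z) := invertibleOfNonzero hc0
  have h := eval₂_reflect_mul_pow (RingHom.id ℂ) (conj z) n (p.map (starRingEnd ℂ)) (by simpa)
  rw [invOf_eq_inv, hc, inv_inv, ← hc] at h
  have h2 : conj (p.eval z) = eval (conj z) (p.map (starRingEnd ℂ)) := by
    rw [eval_map, eval₂_hom]
  change eval z (conjReflect n p) * conj z ^ n = eval (conj z) _ at h
  rw [h2, ← h, hc, inv_pow]
  field_simp

/-- The modulus on the unit circle determines the autocorrelation polynomial. -/
theorem mul_conjReflect_eq_of_norm_eval_eq {n : ℕ} {p q : ℂ[X]} (hp : p.natDegree ≤ n)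
    (hq : q.natDegree ≤ n) (h : ∀ z : ℂ, ‖z‖ = 1 → ‖q.eval z‖ = ‖p.eval z‖) :
    q * conjReflect n q = p * conjReflect n p := by
  -- On the unit circle both sides equal z ^ n times the same squared modulus.
  refine Polynomial.eq_of_infinite_eval_eq _ _ (Set.Infinite.mono (s := Metric.sphere 0 1) ?_ ?_)
  · intro z hz
    have hz : ‖z‖ = 1 := by simpa using hz
    simp only [Set.mem_ofPred_eq, eval_mul, eval_conjReflect hp hz, eval_conjReflect hq hz]
    rw [mul_left_comm, Complex.mul_conj', h z hz, mul_left_comm, Complex.mul_conj']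
  · exact (isPreconnected_sphere (by simp) _ _).infinite_of_nontrivial
      ⟨1, by simp, -1, by simp, by norm_num⟩

/-- Two polynomials with the same modulus on the unit circle differ by a unimodular constant and
the conjugate reciprocation of a factor. -/
theorem exists_factorization_of_mul_conjReflect_eq {M : ℕ} {p q : ℂ[X]} (hp : p.natDegree ≤ M)
    (hq : q.natDegree ≤ M) (hM : p.coeff M ≠ 0) (h0 : p.coeff 0 ≠ 0)
    (h : q * conjReflect M q = p * conjReflect M p) :
    ∃ a b : ℕ, a + b = M ∧ ∃ (f g : ℂ[X]) (c : ℂ), f.natDegree ≤ a ∧ g.natDegree = b ∧ g.Monic ∧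
      ‖c‖ = 1 ∧ p = f * g ∧ q = C c * (f * conjReflect b g) := by
  have hp0 : p ≠ 0 := by rintro rfl; simp at h0
  -- The constant coefficients of the autocorrelations force q, like p, to have degree exactly M.
  have key : q.coeff 0 * conj (q.coeff M) = p.coeff 0 * conj (p.coeff M) := by
    have := congrArg (fun r => coeff r 0) h
    simpa [mul_coeff_zero, coeff_conjReflect] using this
  have hne : q.coeff 0 * conj (q.coeff M) ≠ 0 := by
    rw [key]; exact mul_ne_zero h0 (by simpa using hM)
  have hq00 : q.coeff 0 ≠ 0 := left_ne_zero_of_mul hne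
  have hqM : q.coeff M ≠ 0 := by simpa using right_ne_zero_of_mul hne
  have hq0 : q ≠ 0 := by rintro rfl; simp at hq00
  have hpd : p.natDegree = M := le_antisymm hp (le_natDegree_of_ne_zero hM)
  have hqd : q.natDegree = M := le_antisymm hq (le_natDegree_of_ne_zero hqM)
  obtain ⟨g, k, f, hgk, rfl, rfl⟩ := UniqueFactorizationMonoid.exists_reduced_factors p hp0 q
  have hf0 : f ≠ 0 := left_ne_zero_of_mul hp0
  have hg0 : g ≠ 0 := right_ne_zero_of_mul hp0
  have hk0 : k ≠ 0 := right_ne_zero_of_mul hq0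
  rw [natDegree_mul hf0 hg0] at hpd
  rw [natDegree_mul hf0 hk0] at hqd
  have hkd : k.natDegree = g.natDegree := by omega
  set b := g.natDegree with hb
  rw [← hpd, conjReflect_mul le_rfl le_rfl, conjReflect_mul le_rfl hkd.le] at h
  have hfc : conjReflect f.natDegree f ≠ 0 := by rwa [Ne, conjReflect_eq_zero_iff]
  have h1 : k * conjReflect b k = g * conjReflect b g := by
    apply mul_left_cancel₀ (mul_ne_zero hf0 hfc)
    linear_combination h
  -- With the common factor f removed, g is prime to k and divides k k*, so it divides k*; both
  -- degrees are at most b, so the quotient is constant.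
  have hdvd : g ∣ conjReflect b k := by
    have : g ∣ k * conjReflect b k := ⟨_, h1⟩
    exact hgk.dvd_of_dvd_mul_left this
  obtain ⟨r, hr⟩ := hdvd
  have hkc0 : conjReflect b k ≠ 0 := by rwa [Ne, conjReflect_eq_zero_iff]
  have hr0 : r ≠ 0 := by rintro rfl; simp [hr] at hkc0
  have hrd : r.natDegree = 0 := by
    have h2 := natDegree_conjReflect_le hkd.le
    rw [hr, natDegree_mul hg0 hr0] at h2
    omega
  obtain ⟨c, rfl⟩ := natDegree_eq_zero.1 hrd
  have hk : k = C (conj c) * conjReflect b g := by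
    rw [← conjReflect_conjReflect b k, hr, mul_comm, conjReflect_C_mul]
  have hgc0 : conjReflect b g ≠ 0 := by rwa [Ne, conjReflect_eq_zero_iff]
  have hc : ‖c‖ = 1 := by
    have h2 : C (conj c * c) = (1 : ℂ[X]) := by
      apply mul_left_cancel₀ (mul_ne_zero hg0 hgc0)
      rw [hr] at h1
      rw [C_mul]
      linear_combination h1 - g * C c * hk
    have h3 : conj c * c = 1 := by simpa using C_injective (h2.trans C_1.symm)
    rw [Complex.conj_mul'] at h3
    have h4 : ‖c‖ ^ 2 = 1 := by exact_mod_cast h3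
    exact (pow_eq_one_iff_of_nonneg (norm_nonneg c) two_ne_zero).1 h4
  set l := g.leadingCoeff with hl
  have hl0 : l ≠ 0 := leadingCoeff_ne_zero.2 hg0
  -- Making g monic moves l into f; conjugation turns this into the extra unimodular factor conj l /
  -- l.
  have hg : g = C l * (C l⁻¹ * g) := by
    rw [← mul_assoc, ← C_mul, mul_inv_cancel₀ hl0, C_1, one_mul]
  refine ⟨f.natDegree, b, hpd, C l * f, C l⁻¹ * g, conj c * conj l * l⁻¹, ?_, ?_, ?_, ?_, ?_, ?_⟩
  · exact natDegree_C_mul_le _ _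
  · rw [natDegree_C_mul (inv_ne_zero hl0)]
  · rw [Monic, leadingCoeff_mul, leadingCoeff_C, ← hl, inv_mul_cancel₀ hl0]
  · simp [hc, hl0]
  · conv_lhs => rw [hg]
    ring
  · rw [hk]
    conv_lhs => rw [hg, conjReflect_C_mul]
    have : C l⁻¹ * C l = (1 : ℂ[X]) := by rw [← C_mul, inv_mul_cancel₀ hl0, C_1]
    simp only [C_mul]
    linear_combination (-(C (conj c) * C (conj l) * f * conjReflect b (C l⁻¹ * g))) * this

/-! ### Products of linear forms that take a non-real value -/

theorem eq_zero_of_forall_im_mul_eq_zero {w : ℂ} (h : ∀ e : ℂ, (e * w).im = 0) : w = 0 := by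
  have h1 := h 1
  have h2 := h Complex.I
  apply Complex.ext <;> simp_all

section LinearForms

variable {V : Type*} [AddCommGroup V] [Module ℂ V]

/-- A subspace that lies in neither of the kernels of two linear forms does not lie in their
union. -/
theorem exists_mem_ne_zero_and_ne_zero (W : Submodule ℂ V) {B C : V →ₗ[ℂ] ℂ}
    (hB : ∃ x ∈ W, B x ≠ 0) (hC : ∃ x ∈ W, C x ≠ 0) : ∃ x ∈ W, B x ≠ 0 ∧ C x ≠ 0 := by
  obtain ⟨x, hx, hBx⟩ := hB
  obtain ⟨y, hy, hCy⟩ := hC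
  by_cases hCx : C x = 0
  · by_cases hBy : B y = 0
    · exact ⟨x + y, W.add_mem hx hy, by simpa [hBy], by simpa [hCx]⟩
    · exact ⟨y, hy, hBy, hCy⟩
  · exact ⟨x, hx, hBx, hCx⟩

/-- Move from x to x + s e y with A y and D y nonzero, divide by s and let s tend to 0: the limit e
A(y) conj(B x) conj(C x) D(x) is real for every complex e, hence zero. If D x = 0, the leading order
is s ^ 2 and D y takes the place of D x. -/
theorem mul_apply_eq_zero_of_forall_im_eq_zero {A B C D : V →ₗ[ℂ] ℂ} (hA : ∃ x, A x ≠ 0)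
    (hD : ∃ x, D x ≠ 0) (h : ∀ x, (A x * conj (B x) * conj (C x) * D x).im = 0) {x : V}
    (hx : A x = 0) : B x * C x = 0 := by
  obtain ⟨y, -, hAy, hDy⟩ := exists_mem_ne_zero_and_ne_zero (⊤ : Submodule ℂ V) (B := A) (C := D)
    (by simpa using hA) (by simpa using hD)
  have punctured : ∀ φ : ℝ → ℝ, Continuous φ → (∀ s, s ≠ 0 → φ s = 0) → φ 0 = 0 := by
    intro φ hφ h0
    have := Continuous.ext_on (dense_compl_singleton (0 : ℝ)) hφ continuous_const
      (fun s hs => h0 s hs)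
    exact congrFun this 0
  have h' : ∀ (e : ℂ) (s : ℝ), ((s * (e * A y)) * conj (B x + s * e * B y) *
      conj (C x + s * e * C y) * (D x + s * e * D y)).im = 0 := by
    intro e s
    have := h (x + (s * e) • y)
    simp only [map_add, map_smul, hx, smul_eq_mul, zero_add] at this
    rw [← this, ← mul_assoc (s : ℂ), ← map_add, ← map_add]
  have hDx : conj (B x) * conj (C x) * A y * D x = 0 := by
    apply eq_zero_of_forall_im_mul_eq_zero
    intro e
    have := punctured (fun s => (e * A y * conj (B x + s * e * B y) *
      conj (C x + s * e * C y) * (D x + s * e * D y)).im) (by fun_prop) (by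
        intro s hs
        have := h' e s
        rw [mul_assoc (s : ℂ), mul_assoc (s : ℂ), mul_assoc (s : ℂ), Complex.im_ofReal_mul] at this
        exact (mul_eq_zero.1 this).resolve_left hs)
    simp only [Complex.ofReal_zero, zero_mul, add_zero] at this
    rw [← this]; ring_nf
  have hDy' : conj (B x) * conj (C x) * A y = 0 := by
    by_cases hDx0 : D x = 0
    · have : conj (B x) * conj (C x) * A y * D y = 0 := by
        apply eq_zero_of_forall_im_mul_eq_zero
        intro e
        -- The leading coefficient is now quadratic in the direction, so an arbitrary e is reached
        -- as a square.
        obtain ⟨d, rfl⟩ := IsAlgClosed.exists_pow_nat_eq e (n := 2) (by norm_num)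
        have := punctured (fun s => (d ^ 2 * A y * conj (B x + s * d * B y) *
          conj (C x + s * d * C y) * D y).im) (by fun_prop) (by
            intro s hs
            have := h' d s
            rw [hDx0, show ∀ u v : ℂ, s * (d * A y) * u * v * (0 + s * d * D y) =
              ((s ^ 2 : ℝ) : ℂ) * (d ^ 2 * A y * u * v * D y) by intros; push_cast; ring,
              Complex.im_ofReal_mul] at this
            exact (mul_eq_zero.1 this).resolve_left (pow_ne_zero 2 hs))
        simp only [Complex.ofReal_zero, zero_mul, add_zero] at this
        rw [← this]; ring_nf
      exact (mul_eq_zero.1 this).resolve_right hDy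
    · exact (mul_eq_zero.1 hDx).resolve_right hDx0
  have := (mul_eq_zero.1 hDy').resolve_right hAy
  simpa using this

theorem exists_im_ne_zero {A B C D : V →ₗ[ℂ] ℂ} (hB : ∃ x, A x = 0 ∧ B x ≠ 0)
    (hC : ∃ x, A x = 0 ∧ C x ≠ 0) (hA : ∃ x, A x ≠ 0) (hD : ∃ x, D x ≠ 0) :
    ∃ x, (A x * conj (B x) * conj (C x) * D x).im ≠ 0 := by
  by_contra! h
  obtain ⟨x, hx, hBx, hCx⟩ := exists_mem_ne_zero_and_ne_zero (LinearMap.ker A) (B := B) (C := C)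
    (by simpa using hB) (by simpa using hC)
  exact mul_ne_zero hBx hCx (mul_apply_eq_zero_of_forall_im_eq_zero hA hD h hx)

/-- If neither x nor y lies in the kernel of A, then A(x) y - A(y) x does, and B takes there the
value of a nonzero 2 × 2 minor. -/
theorem exists_apply_eq_zero_and_ne_zero {A B : V →ₗ[ℂ] ℂ} {x y : V} (hx : B x ≠ 0) (hy : B y ≠ 0)
    (h : A x ≠ 0 → A y ≠ 0 → A x * B y ≠ A y * B x) : ∃ z, A z = 0 ∧ B z ≠ 0 := by
  by_cases hAx : A x = 0
  · exact ⟨x, hAx, hx⟩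
  by_cases hAy : A y = 0
  · exact ⟨y, hAy, hy⟩
  refine ⟨A x • y - A y • x, ?_, ?_⟩
  · simp [mul_comm]
  · simpa [sub_eq_zero] using h hAx hAy

end LinearForms

/-! ### The phase form and pairs of factors where it is nonzero -/

/-- This number is real whenever `p` and `q` have the same phases at `n₁` and at `n₂`. -/
noncomputable def phaseForm (n₁ n₂ : ℕ) (p q : ℂ[X]) : ℝ :=
  (q.coeff n₁ * conj (q.coeff n₂) * conj (p.coeff n₁) * p.coeff n₂).im

theorem coeff_sum_range_C_mul_X_pow (c : ℕ → ℂ) (n k : ℕ) :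
    (∑ i ∈ Finset.range n, C (c i) * X ^ i).coeff k = if k < n then c k else 0 := by
  simp only [finsetSum_coeff, coeff_C_mul_X_pow, Finset.sum_ite_eq, Finset.mem_range]

/-- The monic polynomial of degree `b` with coefficients `2 ^ (b - k) ^ 2`. -/
noncomputable def gaussPoly (b : ℕ) : ℂ[X] :=
  ∑ k ∈ Finset.range (b + 1), C (2 ^ (b - k) ^ 2) * X ^ k

theorem coeff_gaussPoly (b k : ℕ) :
    (gaussPoly b).coeff k = if k ≤ b then 2 ^ (b - k) ^ 2 else 0 := by
  simp only [gaussPoly, coeff_sum_range_C_mul_X_pow, Nat.lt_succ_iff]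

theorem natDegree_gaussPoly (b : ℕ) : (gaussPoly b).natDegree = b := by
  apply natDegree_eq_of_le_of_coeff_ne_zero
  · rw [natDegree_le_iff_coeff_eq_zero]
    intro k hk
    rw [coeff_gaussPoly, if_neg (by omega)]
  · simp [coeff_gaussPoly]

theorem monic_gaussPoly (b : ℕ) : (gaussPoly b).Monic := by
  rw [Monic, leadingCoeff, natDegree_gaussPoly, coeff_gaussPoly]; simp

theorem coeff_conjReflect_gaussPoly (b k : ℕ) :
    (conjReflect b (gaussPoly b)).coeff k = if k ≤ b then 2 ^ k ^ 2 else 0 := by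
  split_ifs with h
  · rw [coeff_conjReflect _ h, coeff_gaussPoly, if_pos (by omega), Nat.sub_sub_self h,
      map_pow, Complex.conj_ofNat]
  · exact coeff_eq_zero_of_natDegree_lt (lt_of_le_of_lt
      (natDegree_conjReflect_le (natDegree_gaussPoly b).le) (by omega))

/-- Take g = `gaussPoly b` and let f vary. The kernel conditions of `exists_im_ne_zero` are tested
on two consecutive monomials, where the values are powers of 2 with square exponents; a vanishing
minor would be a linear relation between indices, which is impossible. -/
theorem exists_phaseForm_ne_zero_of_pos {a b n₁ n₂ : ℕ} (ha : 1 ≤ a) (hb : 1 ≤ b) (h₁ : 1 ≤ n₁)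
    (h₁' : n₁ < a + b) (h₂ : 1 ≤ n₂) (h₂' : n₂ < a + b) (hne : n₁ ≠ n₂) :
    ∃ f g : ℂ[X], f.natDegree ≤ a ∧ g.natDegree = b ∧ g.Monic ∧
      phaseForm n₁ n₂ (f * g) (f * conjReflect b g) ≠ 0 := by
  let L (g : ℂ[X]) (n : ℕ) : degreeLE ℂ a →ₗ[ℂ] ℂ :=
    (lcoeff ℂ n) ∘ₗ (LinearMap.mulRight ℂ g) ∘ₗ (degreeLE ℂ a).subtype
  let e (i : ℕ) (hi : i ≤ a) : degreeLE ℂ a :=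
    ⟨X ^ i, mem_degreeLE.2 ((degree_X_pow_le i).trans (by exact_mod_cast hi))⟩
  have hL : ∀ g n i hi, L g n (e i hi) = if i ≤ n then g.coeff (n - i) else 0 := by
    intro g n i hi
    exact coeff_X_pow_mul' g i n
  set p := gaussPoly b with hp
  set r := conjReflect b (gaussPoly b) with hr
  have hLp : ∀ n i hi, i ≤ n → n - i ≤ b → L p n (e i hi) = 2 ^ (b - (n - i)) ^ 2 := by
    intro n i hi h h'
    rw [hL _ _ _ hi, if_pos h, coeff_gaussPoly, if_pos h']
  have hLr : ∀ n i hi, i ≤ n → n - i ≤ b → L r n (e i hi) = 2 ^ (n - i) ^ 2 := by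
    intro n i hi h h'
    rw [hL _ _ _ hi, if_pos h, coeff_conjReflect_gaussPoly, if_pos h']
  have hLr0 : ∀ n i hi, L r n (e i hi) ≠ 0 → i ≤ n ∧ n - i ≤ b := by
    intro n i hi h
    rw [hL _ _ _ hi, coeff_conjReflect_gaussPoly] at h
    by_contra! h'
    split_ifs at h with h1 h2
    · have := h' h1
      omega
    · exact h rfl
    · exact h rfl
  have hpos : ∀ m : ℕ, (2 : ℂ) ^ m ≠ 0 := fun m => pow_ne_zero m two_ne_zero
  -- Both X ^ i and X ^ (i + 1) contribute to the coefficient at n. The witness uses truncated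
  -- subtraction: i = 0 when n ≤ b.
  have hwin : ∀ n, 1 ≤ n → n < a + b → ∃ i, i + 1 ≤ a ∧ i + 1 ≤ n ∧ n - i ≤ b :=
    fun n _ _ => ⟨n - b, by omega, by omega, by omega⟩
  have hpow : ∀ m n : ℕ, (2 : ℂ) ^ m = 2 ^ n → m = n := by
    intro m n h
    exact Nat.pow_right_injective le_rfl (by exact_mod_cast h)
  obtain ⟨i, hia, hin, hib⟩ := hwin n₁ h₁ h₁'
  obtain ⟨j, hja, hjn, hjb⟩ := hwin n₂ h₂ h₂'
  have hia' : i ≤ a := by omega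
  have hja' : j ≤ a := by omega
  obtain ⟨f, hf⟩ := exists_im_ne_zero (A := L r n₁) (B := L r n₂) (C := L p n₁) (D := L p n₂)
    (exists_apply_eq_zero_and_ne_zero (x := e j hja') (y := e (j + 1) hja)
      (by rw [hLr _ _ hja' (by omega) (by omega)]; exact hpos _)
      (by rw [hLr _ _ hja (by omega) (by omega)]; exact hpos _)
      (by
        intro hx hy h
        obtain ⟨hx1, hx2⟩ := hLr0 _ _ hja' hx
        obtain ⟨hy1, hy2⟩ := hLr0 _ _ hja hy
        rw [hLr n₁ j hja' hx1 hx2, hLr n₁ (j + 1) hja hy1 hy2, hLr n₂ j hja' (by omega) (by omega),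
          hLr n₂ (j + 1) hja (by omega) (by omega), ← pow_add, ← pow_add] at h
        have := hpow _ _ h
        obtain ⟨k, hk⟩ : ∃ k, n₁ = j + 1 + k := ⟨n₁ - (j + 1), by omega⟩
        obtain ⟨l, hl⟩ : ∃ l, n₂ = j + 1 + l := ⟨n₂ - (j + 1), by omega⟩
        rw [show n₁ - j = k + 1 by omega, show n₁ - (j + 1) = k by omega,
          show n₂ - j = l + 1 by omega, show n₂ - (j + 1) = l by omega] at this
        -- The exponents give (k + 1)² + l² = k² + (l + 1)², so n₁ = n₂. The second minor below
        -- gives (k + 1)² + (l + 1)² = k² + l² instead.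
        have hkl : k = l := by linarith
        omega))
    (exists_apply_eq_zero_and_ne_zero (x := e i hia') (y := e (i + 1) hia)
      (by rw [hLp _ _ hia' (by omega) (by omega)]; exact hpos _)
      (by rw [hLp _ _ hia (by omega) (by omega)]; exact hpos _)
      (by
        intro _ _ h
        rw [hLr n₁ i hia' (by omega) (by omega), hLr n₁ (i + 1) hia (by omega) (by omega),
          hLp n₁ i hia' (by omega) (by omega), hLp n₁ (i + 1) hia (by omega) (by omega),
          ← pow_add, ← pow_add] at h
        have := hpow _ _ h
        obtain ⟨k, hk⟩ : ∃ k, n₁ = i + 1 + k := ⟨n₁ - (i + 1), by omega⟩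
        obtain ⟨l, hl⟩ : ∃ l, b = k + 1 + l := ⟨b - (k + 1), by omega⟩
        rw [show n₁ - i = k + 1 by omega, show n₁ - (i + 1) = k by omega,
          show b - k = l + 1 by omega, show b - (k + 1) = l by omega] at this
        linarith))
    ⟨e i hia', by rw [hLr _ _ hia' (by omega) (by omega)]; exact hpos _⟩
    ⟨e j hja', by rw [hLp _ _ hja' (by omega) (by omega)]; exact hpos _⟩
  refine ⟨f, p, natDegree_le_of_degree_le (mem_degreeLE.1 f.2), natDegree_gaussPoly b,
    monic_gaussPoly b, hf⟩

theorem exists_phaseForm_ne_zero_of_add_ne {M n₁ n₂ : ℕ} (h₁ : 1 ≤ n₁)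
    (h₁' : n₁ < M) (h₂ : 1 ≤ n₂) (h₂' : n₂ < M) (hne : n₁ ≠ n₂) (hM : n₁ + n₂ ≠ M) :
    ∃ f g : ℂ[X], f.natDegree ≤ 0 ∧ g.natDegree = M ∧ g.Monic ∧
      phaseForm n₁ n₂ (f * g) (f * conjReflect M g) ≠ 0 := by
  let g : ℂ[X] := ∑ k ∈ Finset.range (M + 1), C (if k = n₁ then 1 + 2 * Complex.I else 1) * X ^ k
  have hg : ∀ k, g.coeff k = if k ≤ M then (if k = n₁ then 1 + 2 * Complex.I else 1) else 0 := by
    intro k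
    simp only [g, coeff_sum_range_C_mul_X_pow, Nat.lt_succ_iff]
  have hgd : g.natDegree = M := by
    apply natDegree_eq_of_le_of_coeff_ne_zero
    · rw [natDegree_le_iff_coeff_eq_zero]
      intro k hk
      rw [hg, if_neg (by omega)]
    · rw [hg, if_pos le_rfl, if_neg (by omega)]; exact one_ne_zero
  refine ⟨1, g, by simp, hgd, ?_, ?_⟩
  · rw [Monic, leadingCoeff, hgd, hg, if_pos le_rfl, if_neg (by omega)]
  · rw [phaseForm, one_mul, one_mul, coeff_conjReflect _ h₁'.le, coeff_conjReflect _ h₂'.le]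
    rw [hg (M - n₁), hg (M - n₂), hg n₁, hg n₂, if_pos (show M - n₁ ≤ M by omega),
      if_pos (show M - n₂ ≤ M by omega), if_pos h₁'.le, if_pos h₂'.le,
      if_neg (show M - n₂ ≠ n₁ by omega), if_pos rfl, if_neg hne.symm]
    -- Only index n₁ carries 1 + 2i, and M - n₂ ≠ n₁. If M - n₁ = n₁ the conjugate of this number
    -- enters squared, and its square is still not real.
    split_ifs <;> simp

/-! ### Signals as polynomials -/

theorem toSignal_natCast {N : ℕ} (v : Fin N → ℂ) (k : ℕ) :
    toSignal v k = if h : k < N then v ⟨k, h⟩ else 0 := by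
  simp [toSignal]

theorem support_toSignal_subset {N : ℕ} (v : Fin N → ℂ) :
    Function.support (toSignal v) ⊆ Set.Icc 0 ((N : ℤ) - 1) := by
  intro n hn
  by_contra h
  refine hn (dif_neg fun h' => h ?_)
  exact ⟨h'.1, by omega⟩

/-- The polynomial whose coefficients are the values of a signal on `{0, …, N - 1}`. -/
noncomputable def signalPoly (N : ℕ) (x : ℤ → ℂ) : ℂ[X] := ∑ i ∈ Finset.range N, C (x i) * X ^ i

theorem coeff_signalPoly (N : ℕ) (x : ℤ → ℂ) (k : ℕ) :
    (signalPoly N x).coeff k = if k < N then x k else 0 :=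
  coeff_sum_range_C_mul_X_pow (fun i => x i) N k

theorem natDegree_signalPoly_le (M : ℕ) (x : ℤ → ℂ) : (signalPoly (M + 1) x).natDegree ≤ M := by
  rw [natDegree_le_iff_coeff_eq_zero]
  intro k hk
  rw [coeff_signalPoly, if_neg (by omega)]

/-! ### Analytic dependence on parameters and generic signals -/

section Analytic

variable {E : Type*} [NormedAddCommGroup E] [NormedSpace ℝ E]

theorem analyticOnNhd_coeff_mul {P Q : E → ℂ[X]}
    (hP : ∀ k, AnalyticOnNhd ℝ (fun u => (P u).coeff k) Set.univ)
    (hQ : ∀ k, AnalyticOnNhd ℝ (fun u => (Q u).coeff k) Set.univ) (k : ℕ) :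
    AnalyticOnNhd ℝ (fun u => (P u * Q u).coeff k) Set.univ := by
  simp only [coeff_mul]
  exact Finset.analyticOnNhd_fun_sum _ fun i _ => (hP _).mul (hQ _)

theorem analyticOnNhd_conj {f : E → ℂ} (hf : AnalyticOnNhd ℝ f Set.univ) :
    AnalyticOnNhd ℝ (fun u => conj (f u)) Set.univ :=
  fun u hu => (Complex.conjCLE.toContinuousLinearMap.analyticAt _).fun_comp (hf u hu)

theorem analyticOnNhd_im {f : E → ℂ} (hf : AnalyticOnNhd ℝ f Set.univ) :
    AnalyticOnNhd ℝ (fun u => (f u).im) Set.univ :=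
  fun u hu => (Complex.imCLM.analyticAt _).fun_comp (hf u hu)

theorem analyticOnNhd_normSq {f : E → ℂ} (hf : AnalyticOnNhd ℝ f Set.univ) :
    AnalyticOnNhd ℝ (fun u => Complex.normSq (f u)) Set.univ := by
  have hre : AnalyticOnNhd ℝ (fun u => (f u).re) Set.univ :=
    fun u hu => (Complex.reCLM.analyticAt _).fun_comp (hf u hu)
  simp only [Complex.normSq_apply]
  exact (hre.mul hre).add ((analyticOnNhd_im hf).mul (analyticOnNhd_im hf))

theorem analyticOnNhd_coeff_conjReflect {P : E → ℂ[X]}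
    (hP : ∀ k, AnalyticOnNhd ℝ (fun u => (P u).coeff k) Set.univ) (n k : ℕ) :
    AnalyticOnNhd ℝ (fun u => (conjReflect n (P u)).coeff k) Set.univ := by
  simp only [conjReflect, coeff_reflect, coeff_map]
  exact analyticOnNhd_conj (hP _)

theorem analyticOnNhd_phaseForm {P Q : E → ℂ[X]}
    (hP : ∀ k, AnalyticOnNhd ℝ (fun u => (P u).coeff k) Set.univ)
    (hQ : ∀ k, AnalyticOnNhd ℝ (fun u => (Q u).coeff k) Set.univ) (n₁ n₂ : ℕ) :
    AnalyticOnNhd ℝ (fun u => phaseForm n₁ n₂ (P u) (Q u)) Set.univ :=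
  analyticOnNhd_im ((((hQ n₁).mul (analyticOnNhd_conj (hQ n₂))).mul
    (analyticOnNhd_conj (hP n₁))).mul (hP n₂))

theorem analyticOnNhd_toSignal {N : ℕ} (n : ℤ) :
    AnalyticOnNhd ℝ (fun v : Fin N → ℂ => toSignal v n) Set.univ := by
  intro v _
  unfold toSignal
  split_ifs with h
  · exact (ContinuousLinearMap.proj (R := ℝ) (φ := fun _ : Fin N => ℂ) _).analyticAt v
  · exact analyticAt_const

end Analytic

/-- The polynomial of degree at most `a` with the first `a + 1` entries of `u` as coefficients. -/
noncomputable def firstFactor (a : ℕ) {N : ℕ} (u : Fin N → ℂ) : ℂ[X] := signalPoly (a + 1) (toSignal u)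

/-- The monic polynomial of degree `b` whose lower coefficients are the entries of `u` from the
position `a + 1` on. -/
noncomputable def secondFactor (a b : ℕ) {N : ℕ} (u : Fin N → ℂ) : ℂ[X] :=
  X ^ b + signalPoly b fun n => toSignal u (n + (a + 1 : ℕ))

/-- The a + 1 coefficients of f and the b free coefficients of the monic g fill exactly the a + b +
1 coordinates of a signal. -/
theorem exists_factors_eq {a b : ℕ} {f g : ℂ[X]} (hf : f.natDegree ≤ a) (hg : g.natDegree = b)
    (hgm : g.Monic) :
    ∃ u : Fin (a + b + 1) → ℂ, firstFactor a u = f ∧ secondFactor a b u = g := by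
  refine ⟨fun i => if (i : ℕ) ≤ a then f.coeff i else g.coeff (i - (a + 1)), ?_, ?_⟩
  · ext k
    rw [firstFactor, coeff_signalPoly]
    split_ifs with h
    · rw [toSignal_natCast, dif_pos (by omega), if_pos (by simp; omega)]
    · rw [coeff_eq_zero_of_natDegree_lt (by omega)]
  · ext k
    rw [secondFactor, coeff_add, coeff_signalPoly, coeff_X_pow, ← Nat.cast_add, toSignal_natCast]
    rcases lt_trichotomy k b with h | h | h
    · rw [if_neg h.ne, if_pos h, dif_pos (by omega), if_neg (by simp; omega), zero_add]
      simp
    · subst h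
      rw [if_pos rfl, if_neg (lt_irrefl _), add_zero, ← hg]
      exact hgm.symm
    · rw [if_neg h.ne', if_neg (by omega), coeff_eq_zero_of_natDegree_lt (by omega), add_zero]

theorem analyticOnNhd_coeff_firstFactor (a N k : ℕ) :
    AnalyticOnNhd ℝ (fun u : Fin N → ℂ => (firstFactor a u).coeff k) Set.univ := by
  simp only [firstFactor, coeff_signalPoly]
  split_ifs
  · exact analyticOnNhd_toSignal _
  · exact analyticOnNhd_const

theorem analyticOnNhd_coeff_secondFactor (a b N k : ℕ) :
    AnalyticOnNhd ℝ (fun u : Fin N → ℂ => (secondFactor a b u).coeff k) Set.univ := by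
  simp only [secondFactor, coeff_add, coeff_signalPoly]
  refine analyticOnNhd_const.add ?_
  split_ifs
  · exact analyticOnNhd_toSignal _
  · exact analyticOnNhd_const

/-- If the phase form does not vanish identically on the pairs of factors of degrees `a` and `b`,
then for almost every signal it vanishes at no such factorization. -/
theorem ae_forall_phaseForm_ne_zero {a b n₁ n₂ : ℕ}
    (h : ∃ f g : ℂ[X], f.natDegree ≤ a ∧ g.natDegree = b ∧ g.Monic ∧
      phaseForm n₁ n₂ (f * g) (f * conjReflect b g) ≠ 0) :
    ∀ᵐ v : Fin (a + b + 1) → ℂ, ∀ f g : ℂ[X], f.natDegree ≤ a → g.natDegree = b → g.Monic →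
      signalPoly (a + b + 1) (toSignal v) = f * g →
      phaseForm n₁ n₂ (f * g) (f * conjReflect b g) ≠ 0 := by
  let N := a + b + 1
  let F : (Fin N → ℂ) → ℂ[X] := firstFactor a
  let G : (Fin N → ℂ) → ℂ[X] := secondFactor a b
  let Φ : (Fin N → ℂ) → ℝ := fun u => phaseForm n₁ n₂ (F u * G u) (F u * conjReflect b (G u))
  have hF := analyticOnNhd_coeff_firstFactor a N
  have hG := analyticOnNhd_coeff_secondFactor a b N
  have hFG := analyticOnNhd_coeff_mul hF hG
  have hΦ : AnalyticOnNhd ℝ Φ Set.univ := analyticOnNhd_phaseForm hFG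
    (analyticOnNhd_coeff_mul hF (analyticOnNhd_coeff_conjReflect hG b)) n₁ n₂
  obtain ⟨f, g, hf, hg, hgm, hfg⟩ := h
  obtain ⟨u, rfl, rfl⟩ := exists_factors_eq hf hg hgm
  have hnull : volume {u | Φ u = 0} = 0 := hΦ.addHaar_zeros_eq_zero volume hfg
  -- Multiplication of the factors is a differentiable map between spaces of equal dimension, so it
  -- carries null sets to null sets.
  have hdiff : DifferentiableOn ℝ (fun u (i : Fin N) => (F u * G u).coeff i) {u | Φ u = 0} := by
    rw [differentiableOn_pi]
    exact fun i => (hFG i).differentiableOn.mono (Set.subset_univ _)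
  have himage := addHaar_image_eq_zero_of_differentiableOn_of_addHaar_eq_zero volume hdiff hnull
  rw [ae_iff]
  refine measure_mono_null ?_ himage
  intro v hv
  simp only [Set.mem_ofPred_eq, not_forall, not_not] at hv
  obtain ⟨f, g, hf, hg, hgm, hv, h0⟩ := hv
  obtain ⟨u, rfl, rfl⟩ := exists_factors_eq hf hg hgm
  refine ⟨u, h0, ?_⟩
  ext i
  change (firstFactor a u * secondFactor a b u).coeff i = v i
  rw [← hv, coeff_signalPoly, if_pos i.2, toSignal_natCast, dif_pos i.2]

/-- Nonzero values at n₁ and n₂ give genuine phases, nonzero end values fix the degree, and end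
values of different modulus separate the signal from its reflections. -/
theorem ae_toSignal_generic {M n₁ n₂ : ℕ} (hM : M ≠ 0) (h₁ : n₁ ≤ M) (h₂ : n₂ ≤ M) :
    ∀ᵐ v : Fin (M + 1) → ℂ, toSignal v n₁ ≠ 0 ∧ toSignal v n₂ ≠ 0 ∧
      toSignal v (0 : ℕ) ≠ 0 ∧ toSignal v M ≠ 0 ∧ ‖toSignal v (0 : ℕ)‖ ≠ ‖toSignal v M‖ := by
  let s (k : ℕ) (v : Fin (M + 1) → ℂ) : ℝ := Complex.normSq (toSignal v k)
  let Φ : (Fin (M + 1) → ℂ) → ℝ := fun v => s n₁ v * s n₂ v * s 0 v * s M v * (s 0 v - s M v)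
  have hs : ∀ k, AnalyticOnNhd ℝ (s k) Set.univ :=
    fun k => analyticOnNhd_normSq (analyticOnNhd_toSignal _)
  have hΦ : AnalyticOnNhd ℝ Φ Set.univ :=
    ((((hs _).mul (hs _)).mul (hs _)).mul (hs _)).mul ((hs _).sub (hs _))
  let w : Fin (M + 1) → ℂ := fun i => if (i : ℕ) = 0 then 2 else 1
  have hw : ∀ k, k ≤ M → s k w = if k = 0 then 4 else 1 := by
    intro k hk
    simp only [s, toSignal_natCast, dif_pos (Nat.lt_succ_of_le hk), w]
    split_ifs <;> norm_num [Complex.normSq_ofNat]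
  have hw0 : Φ w ≠ 0 := by
    simp only [Φ, hw _ h₁, hw _ h₂, hw 0 (Nat.zero_le _), hw M le_rfl, if_neg hM]
    split_ifs <;> norm_num
  have hnull := hΦ.addHaar_zeros_eq_zero volume hw0
  rw [← compl_mem_ae_iff] at hnull
  filter_upwards [hnull] with v hv
  have hv : Φ v ≠ 0 := hv
  simp only [Φ, s, mul_ne_zero_iff, sub_ne_zero, Complex.normSq_eq_norm_sq, ne_eq,
    pow_eq_zero_iff two_ne_zero, norm_eq_zero] at hv
  obtain ⟨⟨⟨⟨h1, h2⟩, h3⟩, h4⟩, h5⟩ := hv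
  exact ⟨h1, h2, h3, h4, fun h => h5 (by rw [h])⟩

/-! ### Intensity, phases and reflection in terms of polynomials -/

theorem fourierTransform_eq_eval {N : ℕ} {x : ℤ → ℂ}
    (hx : Function.support x ⊆ Set.Icc 0 ((N : ℤ) - 1)) (ω : ℝ) :
    fourierTransform x ω = (signalPoly N x).eval (Complex.exp (-Complex.I * ω)) := by
  have hsub : (Function.support fun n : ℤ => x n * Complex.exp (-Complex.I * (ω : ℂ) * (n : ℂ))) ⊆
      ((Finset.range N).map Nat.castEmbedding : Finset ℤ) := by
    intro n hn
    have hn' := hx (left_ne_zero_of_mul hn)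
    simp only [Finset.coe_map, Set.mem_image, Finset.coe_range, Set.mem_Iio, Nat.castEmbedding_apply]
    have h0 := hn'.1
    have h1 := hn'.2
    exact ⟨n.toNat, by omega, by omega⟩
  rw [fourierTransform, finsum_eq_sum_of_support_subset _ hsub, Finset.sum_map, signalPoly,
    eval_finsetSum]
  refine Finset.sum_congr rfl fun k _ => ?_
  rw [eval_C_mul, eval_pow, eval_X, ← Complex.exp_nat_mul, Nat.castEmbedding_apply, Int.cast_natCast,
    mul_comm (k : ℂ)]

theorem norm_exp_neg_I_mul (ω : ℝ) : ‖Complex.exp (-Complex.I * ω)‖ = 1 := by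
  simp [Complex.norm_exp]

theorem forall_norm_fourierTransform_eq_iff {N : ℕ} {x y : ℤ → ℂ}
    (hx : Function.support x ⊆ Set.Icc 0 ((N : ℤ) - 1))
    (hy : Function.support y ⊆ Set.Icc 0 ((N : ℤ) - 1)) :
    (∀ ω : ℝ, ‖fourierTransform y ω‖ = ‖fourierTransform x ω‖) ↔
      ∀ z : ℂ, ‖z‖ = 1 → ‖(signalPoly N y).eval z‖ = ‖(signalPoly N x).eval z‖ := by
  simp only [fourierTransform_eq_eval hx, fourierTransform_eq_eval hy]
  constructor
  · intro h z hz
    have := h (-Complex.arg z)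
    have hexp : Complex.exp (-Complex.I * ((-Complex.arg z : ℝ) : ℂ)) = z := by
      conv_rhs => rw [← Complex.norm_mul_exp_arg_mul_I z, hz]
      push_cast
      ring_nf
    rwa [hexp] at this
  · exact fun h ω => h _ (norm_exp_neg_I_mul ω)

theorem SamePhase.mul_conj {z w : ℂ} (h : SamePhase z w) : z * conj w = ‖z‖ * ‖w‖ := by
  rcases h with rfl | rfl | h
  · simp
  · simp
  · conv_lhs => rw [← Complex.norm_mul_exp_arg_mul_I z, ← Complex.norm_mul_exp_arg_mul_I w, h]
    rw [map_mul, Complex.conj_ofReal, mul_mul_mul_comm, Complex.mul_conj', Complex.norm_exp_ofReal_mul_I]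
    simp

/-- The product regroups into q_{n₁} conj(p_{n₁}) and the conjugate of q_{n₂} conj(p_{n₂}), both
nonnegative reals. -/
theorem phaseForm_eq_zero {n₁ n₂ : ℕ} {p q : ℂ[X]} (h₁ : SamePhase (q.coeff n₁) (p.coeff n₁))
    (h₂ : SamePhase (q.coeff n₂) (p.coeff n₂)) : phaseForm n₁ n₂ p q = 0 := by
  have h : q.coeff n₁ * conj (q.coeff n₂) * conj (p.coeff n₁) * p.coeff n₂ =
      (q.coeff n₁ * conj (p.coeff n₁)) * conj (q.coeff n₂ * conj (p.coeff n₂)) := by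
    rw [map_mul, Complex.conj_conj]; ring
  rw [phaseForm, h, h₁.mul_conj, h₂.mul_conj, ← Complex.ofReal_mul, ← Complex.ofReal_mul,
    Complex.conj_ofReal, ← Complex.ofReal_mul, Complex.ofReal_im]

theorem phaseForm_C_mul (n₁ n₂ : ℕ) (p q : ℂ[X]) {c : ℂ} (hc : ‖c‖ = 1) :
    phaseForm n₁ n₂ p (C c * q) = phaseForm n₁ n₂ p q := by
  have hcc : c * conj c = 1 := by rw [Complex.mul_conj', hc]; simp
  rw [phaseForm, phaseForm, coeff_C_mul, coeff_C_mul, map_mul]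
  congr 1
  linear_combination q.coeff n₁ * conj (q.coeff n₂) * conj (p.coeff n₁) * p.coeff n₂ * hcc

theorem eq_of_signalPoly_eq {N : ℕ} {x y : ℤ → ℂ}
    (hx : Function.support x ⊆ Set.Icc 0 ((N : ℤ) - 1))
    (hy : Function.support y ⊆ Set.Icc 0 ((N : ℤ) - 1)) (h : signalPoly N y = signalPoly N x) :
    y = x := by
  funext n
  by_cases hn : n ∈ Set.Icc 0 ((N : ℤ) - 1)
  · have h' := congrArg (fun p => coeff p n.toNat) h
    have h0 := hn.1
    have h1 := hn.2
    simpa only [coeff_signalPoly, if_pos (show n.toNat < N by omega), Int.toNat_of_nonneg h0]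
      using h'
  · rw [Function.notMem_support.1 fun h' => hn (hx h'), Function.notMem_support.1 fun h' => hn (hy h')]

theorem support_conjReflection_subset {N : ℕ} {x : ℤ → ℂ}
    (hx : Function.support x ⊆ Set.Icc 0 ((N : ℤ) - 1)) (α : ℝ) :
    Function.support (conjReflection N α x) ⊆ Set.Icc 0 ((N : ℤ) - 1) := by
  intro n hn
  have : x ((N : ℤ) - 1 - n) ≠ 0 := by
    simpa using right_ne_zero_of_mul hn
  obtain ⟨h0, h1⟩ := hx this
  exact ⟨by omega, by omega⟩

theorem signalPoly_conjReflection (M : ℕ) (α : ℝ) (x : ℤ → ℂ) :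
    signalPoly (M + 1) (conjReflection (M + 1) α x) =
      C (Complex.exp (Complex.I * α)) * conjReflect M (signalPoly (M + 1) x) := by
  ext k
  rw [coeff_C_mul, coeff_signalPoly]
  split_ifs with h
  · rw [coeff_conjReflect _ (by omega), coeff_signalPoly, if_pos (by omega), conjReflection,
      Nat.cast_sub (by omega)]
    push_cast
    ring_nf
  · rw [coeff_eq_zero_of_natDegree_lt (lt_of_le_of_lt
      (natDegree_conjReflect_le (natDegree_signalPoly_le M x)) (by omega)), mul_zero]

theorem exp_add_arg_mul_conj (z w : ℂ) :
    Complex.exp (Complex.I * ((z.arg + w.arg : ℝ) : ℂ)) * conj w * ‖z‖ = ‖w‖ * z := by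
  have hw : conj w = ‖w‖ * Complex.exp (w.arg * -Complex.I) := by
    conv_lhs => rw [← Complex.norm_mul_exp_arg_mul_I w]
    rw [map_mul, Complex.conj_ofReal, ← Complex.exp_conj, map_mul, Complex.conj_I,
      Complex.conj_ofReal]
  have hexp : Complex.exp (Complex.I * ((z.arg + w.arg : ℝ) : ℂ)) *
      Complex.exp (w.arg * -Complex.I) = Complex.exp (z.arg * Complex.I) := by
    rw [← Complex.exp_add]; push_cast; ring_nf
  rw [hw, mul_left_comm, hexp, mul_assoc, mul_comm (Complex.exp _),
    Complex.norm_mul_exp_arg_mul_I]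

/-- Conjugation turns the phase of w into its opposite, so the rotation leaves exactly the phase of
z. With z and w the values at n₁ and n₂ in either order, this explains the angle of the rotated
reflection. -/
theorem samePhase_exp_add_arg_mul_conj (z w : ℂ) :
    SamePhase (Complex.exp (Complex.I * ((z.arg + w.arg : ℝ) : ℂ)) * conj w) z := by
  by_cases hz : z = 0
  · exact Or.inr (Or.inl hz)
  by_cases hw : w = 0
  · left; simp [hw]
  right; right
  have hz' : (‖z‖ : ℂ) ≠ 0 := by simpa
  have h : Complex.exp (Complex.I * ((z.arg + w.arg : ℝ) : ℂ)) * conj w =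
      ((‖w‖ / ‖z‖ : ℝ) : ℂ) * z := by
    rw [Complex.ofReal_div, div_mul_eq_mul_div, eq_div_iff hz', exp_add_arg_mul_conj]
  rw [h, Complex.arg_real_mul _ (div_pos (norm_pos_iff.2 hw) (norm_pos_iff.2 hz))]

theorem isSolution_self {N : ℕ} {x : ℤ → ℂ} (hx : Function.support x ⊆ Set.Icc 0 ((N : ℤ) - 1))
    (n₁ n₂ : ℤ) : IsSolution N n₁ n₂ x x :=
  ⟨hx, fun _ => rfl, Or.inr (Or.inr rfl), Or.inr (Or.inr rfl)⟩

theorem isSolution_conjReflection {M : ℕ} {x : ℤ → ℂ} {n₁ n₂ : ℤ}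
    (hx : Function.support x ⊆ Set.Icc 0 (((M + 1 : ℕ) : ℤ) - 1)) (hn : n₁ + n₂ = M) :
    IsSolution (M + 1) n₁ n₂ x (conjReflection (M + 1) (Complex.arg (x n₁) + Complex.arg (x n₂)) x) := by
  have hsupp := support_conjReflection_subset hx (Complex.arg (x n₁) + Complex.arg (x n₂))
  refine ⟨hsupp, ?_, ?_, ?_⟩
  · rw [forall_norm_fourierTransform_eq_iff hx hsupp]
    intro z hz
    rw [signalPoly_conjReflection, eval_C_mul, eval_conjReflect (natDegree_signalPoly_le M x) hz,
      norm_mul, norm_mul, mul_comm Complex.I, Complex.norm_exp_ofReal_mul_I, norm_pow, hz, one_pow,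
      one_mul, one_mul, Complex.norm_conj]
  · rw [conjReflection, show ((M + 1 : ℕ) : ℤ) - 1 - n₁ = n₂ by push_cast; omega]
    exact samePhase_exp_add_arg_mul_conj _ _
  · rw [conjReflection, show ((M + 1 : ℕ) : ℤ) - 1 - n₂ = n₁ by push_cast; omega,
      add_comm (Complex.arg _)]
    exact samePhase_exp_add_arg_mul_conj _ _

theorem conjReflection_ne_self {M : ℕ} {x : ℤ → ℂ} (h : ‖x (0 : ℕ)‖ ≠ ‖x M‖) (α : ℝ) :
    conjReflection (M + 1) α x ≠ x := by
  intro h'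
  apply h
  rw [← congrFun h' (0 : ℕ), conjReflection, norm_mul, mul_comm Complex.I,
    Complex.norm_exp_ofReal_mul_I, one_mul, Complex.norm_conj]
  congr 2
  push_cast; ring

/-! ### Solutions for generic signals -/

/-- If no nontrivial factorization of the signal polynomial makes the phase form vanish, the only
ambiguity left is the conjugate reflection. -/
theorem IsSolution.eq_or_eq_conjReflection {M n₁ n₂ : ℕ} (hn₁ : n₁ ≤ M) (hn₂ : n₂ ≤ M)
    {x y : ℤ → ℂ} (hx : Function.support x ⊆ Set.Icc 0 (((M + 1 : ℕ) : ℤ) - 1))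
    (hx₁ : x n₁ ≠ 0) (hx₂ : x n₂ ≠ 0) (hx0 : x (0 : ℕ) ≠ 0) (hxM : x M ≠ 0)
    (hfac : ∀ a b : ℕ, a + b = M → b ≠ 0 → (a ≠ 0 ∨ n₁ + n₂ ≠ M) → ∀ f g : ℂ[X],
      f.natDegree ≤ a → g.natDegree = b → g.Monic → signalPoly (M + 1) x = f * g →
      phaseForm n₁ n₂ (f * g) (f * conjReflect b g) ≠ 0)
    (hy : IsSolution (M + 1) n₁ n₂ x y) :
    y = x ∨ (n₁ + n₂ = M ∧
      y = conjReflection (M + 1) (Complex.arg (x n₁) + Complex.arg (x n₂)) x) := by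
  have hcoeff : ∀ (z : ℤ → ℂ) (k : ℕ), k ≤ M → (signalPoly (M + 1) z).coeff k = z k := by
    intro z k hk
    rw [coeff_signalPoly, if_pos (by omega)]
  have hint := (forall_norm_fourierTransform_eq_iff hx hy.support_subset).1 hy.intensity
  have hpd := natDegree_signalPoly_le M x
  have hqd := natDegree_signalPoly_le M y
  obtain ⟨a, b, hab, f, g, c, hf, hg, hgm, hc, hp, hq⟩ :=
    exists_factorization_of_mul_conjReflect_eq hpd hqd (by rwa [hcoeff _ _ le_rfl])
      (by rwa [hcoeff _ _ (Nat.zero_le _)]) (mul_conjReflect_eq_of_norm_eval_eq hpd hqd hint)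
  have hform : phaseForm n₁ n₂ (f * g) (f * conjReflect b g) = 0 := by
    rw [← phaseForm_C_mul n₁ n₂ _ _ hc, ← hq, ← hp]
    apply phaseForm_eq_zero
    · rw [hcoeff _ _ hn₁, hcoeff _ _ hn₁]; exact hy.phase₁
    · rw [hcoeff _ _ hn₂, hcoeff _ _ hn₂]; exact hy.phase₂
  have hphase := hy.phase₁.mul_conj
  by_cases hb : b = 0
  · left
    have hg1 : g = 1 := by
      rw [hb] at hg
      exact hgm.natDegree_eq_zero.1 hg
    have hqp : signalPoly (M + 1) y = C c * signalPoly (M + 1) x := by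
      rw [hq, hp, hg1, hb]; simp [conjReflect]
    have hyx : y n₁ = c * x n₁ := by
      rw [← hcoeff y n₁ hn₁, hqp, coeff_C_mul, hcoeff x n₁ hn₁]
    -- Here y = c x, and the common phase at n₁, where x is nonzero, forces c = 1.
    have hc1 : c = 1 := by
      rw [hyx, norm_mul, hc, one_mul, mul_assoc, Complex.mul_conj', ← sq] at hphase
      have h0 : ((‖x n₁‖ : ℂ)) ^ 2 ≠ 0 := pow_ne_zero 2 (by simpa)
      exact mul_right_cancel₀ h0 (by rw [hphase, one_mul])
    exact eq_of_signalPoly_eq hx hy.support_subset (by rw [hqp, hc1, C_1, one_mul])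
  · right
    have hor : ¬ (a ≠ 0 ∨ n₁ + n₂ ≠ M) := fun h => hfac a b hab hb h f g hf hg hgm hp hform
    push Not at hor
    obtain ⟨ha, hsum⟩ := hor
    refine ⟨hsum, ?_⟩
    obtain rfl : b = M := by omega
    rw [ha] at hf
    obtain ⟨t, rfl⟩ := natDegree_eq_zero.1 (Nat.le_zero.1 hf)
    have ht : t ≠ 0 := by
      rintro rfl
      apply hx0
      rw [← hcoeff x 0 (Nat.zero_le _), hp]
      simp
    have ht' : conj t ≠ 0 := by simpa
    -- The constant factor t = f becomes conj t in the reflection of p, so d = c t / conj t.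
    obtain ⟨d, hd, hqd'⟩ : ∃ d : ℂ, ‖d‖ = 1 ∧
        signalPoly (b + 1) y = C d * conjReflect b (signalPoly (b + 1) x) := by
      refine ⟨c * t / conj t, by simp [hc, ht], ?_⟩
      rw [hq, hp, conjReflect_C_mul, ← mul_assoc, ← mul_assoc, ← C_mul, ← C_mul,
        div_mul_cancel₀ _ ht']
    have hyx : y n₁ = d * conj (x n₂) := by
      rw [← hcoeff y n₁ hn₁, hqd', coeff_C_mul, coeff_conjReflect _ hn₁,
        show b - n₁ = n₂ by omega, hcoeff x n₂ hn₂]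
    have hd' : d = Complex.exp (Complex.I * ((Complex.arg (x n₁) + Complex.arg (x n₂) : ℝ) : ℂ)) := by
      have h1 := (samePhase_exp_add_arg_mul_conj (x n₁) (x n₂)).mul_conj
      rw [norm_mul, mul_comm Complex.I, Complex.norm_exp_ofReal_mul_I, ← mul_comm Complex.I] at h1
      rw [hyx, norm_mul, hd, ← h1] at hphase
      have h2 : conj (x n₂) ≠ 0 := by simpa
      have h3 : conj (x n₁) ≠ 0 := by simpa
      exact mul_right_cancel₀ h2 (mul_right_cancel₀ h3 hphase)
    refine eq_of_signalPoly_eq (support_conjReflection_subset hx _) hy.support_subset ?_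
    rw [hqd', signalPoly_conjReflection, hd']

theorem ae_isSolution_imp {M n₁ n₂ : ℕ} (h₁ : 1 ≤ n₁) (h₁' : n₁ < M) (h₂ : 1 ≤ n₂) (h₂' : n₂ < M)
    (hne : n₁ ≠ n₂) :
    ∀ᵐ v : Fin (M + 1) → ℂ, ‖toSignal v (0 : ℕ)‖ ≠ ‖toSignal v M‖ ∧
      ∀ y, IsSolution (M + 1) n₁ n₂ (toSignal v) y → y = toSignal v ∨ (n₁ + n₂ = M ∧
        y = conjReflection (M + 1)
          (Complex.arg (toSignal v n₁) + Complex.arg (toSignal v n₂)) (toSignal v)) := by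
  have hfac : ∀ᵐ v : Fin (M + 1) → ℂ, ∀ a b : ℕ, a + b = M → b ≠ 0 → (a ≠ 0 ∨ n₁ + n₂ ≠ M) →
      ∀ f g : ℂ[X], f.natDegree ≤ a → g.natDegree = b → g.Monic →
      signalPoly (M + 1) (toSignal v) = f * g →
      phaseForm n₁ n₂ (f * g) (f * conjReflect b g) ≠ 0 := by
    simp only [ae_all_iff]
    rintro a b rfl hb hab
    have hex : ∃ f g : ℂ[X], f.natDegree ≤ a ∧ g.natDegree = b ∧ g.Monic ∧
        phaseForm n₁ n₂ (f * g) (f * conjReflect b g) ≠ 0 := by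
      -- For a = 0 the form is identically zero when n₁ + n₂ = M, so this case needs the inequality
      -- in `hab`.
      rcases Nat.eq_zero_or_pos a with rfl | ha
      · rw [zero_add] at h₁' h₂' hab
        exact exists_phaseForm_ne_zero_of_add_ne h₁ h₁' h₂ h₂' hne (by simpa using hab)
      · exact exists_phaseForm_ne_zero_of_pos ha (Nat.pos_of_ne_zero hb) h₁ h₁' h₂ h₂' hne
    exact ae_forall_phaseForm_ne_zero hex
  filter_upwards [hfac, ae_toSignal_generic (show M ≠ 0 by omega) h₁'.le h₂'.le]
    with v hv ⟨hv₁, hv₂, hv0, hvM, hvn⟩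
  exact ⟨hvn, fun y hy => hy.eq_or_eq_conjReflection h₁'.le h₂'.le (support_toSignal_subset v)
    hv₁ hv₂ hv0 hvM hv⟩

end PhaseRetrieval

theorem mainTheorem2 (N ℓ₁ ℓ₂ : ℕ) (h₁ : ℓ₁ ∈ Set.Icc 1 (N - 2)) (h₂ : ℓ₂ ∈ Set.Icc 1 (N - 2))
    (hne : ℓ₁ ≠ ℓ₂) :
    (ℓ₁ + ℓ₂ ≠ N - 1 →
      ∀ᵐ v : Fin N → ℂ ∂volume,
        {y : ℤ → ℂ | PhaseRetrieval.IsSolution N ((N : ℤ) - 1 - ℓ₁) ((N : ℤ) - 1 - ℓ₂)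
            (PhaseRetrieval.toSignal v) y}
          = {PhaseRetrieval.toSignal v}) ∧
    (ℓ₁ + ℓ₂ = N - 1 →
      ∀ᵐ v : Fin N → ℂ ∂volume,
        {y : ℤ → ℂ | PhaseRetrieval.IsSolution N ((N : ℤ) - 1 - ℓ₁) ((N : ℤ) - 1 - ℓ₂)
            (PhaseRetrieval.toSignal v) y}
          = {PhaseRetrieval.toSignal v,
              PhaseRetrieval.conjReflection N
                (Complex.arg (PhaseRetrieval.toSignal v ((N : ℤ) - 1 - ℓ₁))
                  + Complex.arg (PhaseRetrieval.toSignal v ((N : ℤ) - 1 - ℓ₂)))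
                (PhaseRetrieval.toSignal v)} ∧
        PhaseRetrieval.conjReflection N
            (Complex.arg (PhaseRetrieval.toSignal v ((N : ℤ) - 1 - ℓ₁))
              + Complex.arg (PhaseRetrieval.toSignal v ((N : ℤ) - 1 - ℓ₂)))
            (PhaseRetrieval.toSignal v)
          ≠ PhaseRetrieval.toSignal v) := by
  obtain ⟨M, rfl⟩ : ∃ M, N = M + 1 := ⟨N - 1, by have := h₁.1; have := h₁.2; omega⟩
  obtain ⟨h₁, h₁'⟩ := h₁
  obtain ⟨h₂, h₂'⟩ := h₂
  -- With n_j = M - ℓ_j, the conditions ℓ₁ + ℓ₂ = M and n₁ + n₂ = M are equivalent.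
  have e₁ : ((M + 1 : ℕ) : ℤ) - 1 - ℓ₁ = ((M - ℓ₁ : ℕ) : ℤ) := by omega
  have e₂ : ((M + 1 : ℕ) : ℤ) - 1 - ℓ₂ = ((M - ℓ₂ : ℕ) : ℤ) := by omega
  rw [e₁, e₂]
  have hae := PhaseRetrieval.ae_isSolution_imp (M := M) (n₁ := M - ℓ₁) (n₂ := M - ℓ₂)
    (by omega) (by omega) (by omega) (by omega) (by omega)
  constructor
  · intro hsum
    filter_upwards [hae] with v hv
    ext y
    constructor
    · intro hy
      exact (hv.2 y hy).resolve_right fun h => hsum (by omega)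
    · rintro rfl
      exact PhaseRetrieval.isSolution_self (PhaseRetrieval.support_toSignal_subset v) _ _
  · intro hsum
    filter_upwards [hae] with v hv
    refine ⟨?_, PhaseRetrieval.conjReflection_ne_self hv.1 _⟩
    ext y
    constructor
    · intro hy
      exact (hv.2 y hy).imp_right And.right
    · rintro (rfl | rfl)
      · exact PhaseRetrieval.isSolution_self (PhaseRetrieval.support_toSignal_subset v) _ _
      · exact PhaseRetrieval.isSolution_conjReflection (PhaseRetrieval.support_toSignal_subset v)
          (by omega)
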